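/- Conventions. For $u\in L^2(\mathbb R;\mathbb C)$ let $\widehat u$ be its Fourier–Plancherel transform, normalised by $\widehat u(\omega)=\int_{\mathbb R}u(x)e^{ix\omega}\,dx$, let $\langle u,v\rangle_{L^2}=\int_{\mathbb R}\operatorname{Re}(u(x)\overline{v(x)})\,dx$ and, when $\partial_xu\in L^2(\mathbb R)$, $\|u\|_{H^1}^2=\|u\|_{L^2}^2+\|\partial_x u\|_{L^2}^2$. For $h>0$ let $$BL^2_h=\{u\in L^2(\mathbb R;\mathbb C)\;:\;\operatorname{Supp}\widehat u\subset[-\tfrac{\pi}{h},\tfrac{\pi}{h}]\},$$ and for $\xi=(\xi_1,\xi_2)\in\mathbb R^2$ define $\mathcal L^h_\xi:BL^2_h\to\mathbb R$ by $$\mathcal L_\xi^h(u)=\frac12\int_{\mathbb R}\left|\frac{u(x+h)-u(x)}{h}\right|^2dx-\frac14\|u\|_{L^4(\mathbb R)}^4+\frac{\xi_1}{2}\|u\|_{L^2(\mathbb R)}^2+\frac{\xi_2}{2}\langle i\partial_xu,u\rangle_{L^2(\mathbb R)}.$$ Differentials of $\mathcal L_\xi^h$ are Fréchet differentials over $\mathbb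 R$. Theorem. Let $\Omega$ be a relatively compact open subset of $\{\xi\in\mathbb R^2 : \xi_1>(\xi_2/2)^2\}$ (that is, $\Omega$ is open and its closure is compact and contained in this set). There exists $h_0>0$ such that for all $M>0$ there exist $C,\varepsilon>0$ such that for all $0<h<h_0$, all $\xi\in\Omega$ and all $u\in BL^2_h$ with $\|u\|_{H^1(\mathbb R)}\le M$, $$\mathrm d\mathcal L_\xi^h(u)=0\quad\Longrightarrow\quad|\widehat u(\omega)|<C\,e^{-\varepsilon|\omega|}\ \text{ for almost every }\omega\in\mathbb R .$$ -/

import Mathlib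

open MeasureTheory
open scoped FourierTransform SchwartzMap ENNReal

noncomputable section

/-- The space `L²(ℝ; ℂ)`. -/
abbrev L2C : Type := Lp ℂ 2 (volume : Measure ℝ)

/-- The Fourier–Plancherel transform with the normalisation `û(ω) = ∫ u(x) e^{i x ω} dx`.
Mathlib's transform on `L²` is `𝓕 u (w) = ∫ u(x) e^{-2 π i x w} dx`, so `û(ω) = 𝓕 u (-ω / (2π))`.
As for every element of `L²`, only its values up to null sets are meaningful. -/
def hat (u : L2C) : ℝ → ℂ := fun ω => (𝓕 u : L2C) (-ω / (2 * Real.pi))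

theorem quasiMeasurePreserving_hatScale :
    Measure.QuasiMeasurePreserving (fun ω : ℝ => -ω / (2 * Real.pi)) volume volume := by
  have hc : -(2 * Real.pi)⁻¹ ≠ 0 := by
    have := Real.pi_pos
    simp [this.ne']
  have h1 : (fun ω : ℝ => -ω / (2 * Real.pi)) = fun ω => -(2 * Real.pi)⁻¹ * ω := by
    funext ω; ring
  rw [h1]
  refine ⟨by fun_prop, ?_⟩
  rw [Real.map_volume_mul_left hc]
  exact Measure.smul_absolutelyContinuous

theorem hat_add (u v : L2C) : hat (u + v) =ᵐ[volume] fun ω => hat u ω + hat v ω := by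
  have h : (𝓕 (u + v) : L2C) =ᵐ[volume] fun w => (𝓕 u : L2C) w + (𝓕 v : L2C) w := by
    rw [FourierTransform.fourier_add]
    exact Lp.coeFn_add _ _
  exact quasiMeasurePreserving_hatScale.ae h

theorem hat_smul (c : ℂ) (u : L2C) : hat (c • u) =ᵐ[volume] fun ω => c * hat u ω := by
  have h : (𝓕 (c • u) : L2C) =ᵐ[volume] fun w => c * (𝓕 u : L2C) w := by
    rw [FourierTransform.fourier_smul]
    exact Lp.coeFn_smul _ _
  exact quasiMeasurePreserving_hatScale.ae h

theorem hat_zero : hat 0 =ᵐ[volume] fun _ => (0 : ℂ) := by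
  have h := hat_smul 0 0
  simpa using h

/-- The space `BL²_h` of the `u ∈ L²(ℝ; ℂ)` such that `Supp û ⊆ [-π/h, π/h]`, i.e. such that
`û` vanishes almost everywhere off `[-π/h, π/h]`. -/
def BL (h : ℝ) : Submodule ℂ L2C where
  carrier := {u | ∀ᵐ ω : ℝ, ω ∉ Set.Icc (-(Real.pi / h)) (Real.pi / h) → hat u ω = 0}
  add_mem' := by
    intro u v hu hv
    filter_upwards [hu, hv, hat_add u v] with ω h1 h2 h3 hω
    rw [h3, h1 hω, h2 hω, add_zero]
  zero_mem' := by
    filter_upwards [hat_zero] with ω h1 _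
    exact h1
  smul_mem' := by
    intro c u hu
    filter_upwards [hu, hat_smul c u] with ω h1 h2 hω
    rw [h2, h1 hω, mul_zero]

/-- `w ∈ L²` is the derivative of `u ∈ L²` in the sense of (tempered) distributions. -/
def IsL2Deriv (u w : L2C) : Prop :=
  TemperedDistribution.derivCLM ℂ (u : 𝓢'(ℝ, ℂ)) = (w : 𝓢'(ℝ, ℂ))

theorem IsL2Deriv.unique {u w w' : L2C} (hw : IsL2Deriv u w) (hw' : IsL2Deriv u w') : w = w' := by
  have h : Lp.toTemperedDistributionCLM ℂ volume 2 (w - w') = 0 := by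
    rw [map_sub, sub_eq_zero]
    exact hw.symm.trans hw'
  have h2 := Lp.ker_toTemperedDistributionCLM_eq_bot (F := ℂ) (μ := (volume : Measure ℝ)) (p := 2)
  have h3 : w - w' ∈ (⊥ : Submodule ℂ L2C) := by
    rw [← h2]; exact h
  exact sub_eq_zero.mp (by simpa using h3)

theorem derivCLM_eq_lineDeriv (f : 𝓢'(ℝ, ℂ)) :
    TemperedDistribution.derivCLM ℂ f = LineDeriv.lineDerivOp (1 : ℝ) f := by
  ext g
  rw [TemperedDistribution.derivCLM_apply_apply, TemperedDistribution.lineDerivOp_apply_apply]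
  congr 1

theorem fourier_eq_zero_of_mem_BL {h : ℝ} (u : BL h) :
    ∀ᵐ w : ℝ, Real.pi / h < 2 * Real.pi * |w| → (𝓕 (u : L2C) : L2C) w = 0 := by
  have hpi := Real.pi_pos
  have hq : Measure.QuasiMeasurePreserving (fun w : ℝ => -(2 * Real.pi) * w) volume volume := by
    refine ⟨by fun_prop, ?_⟩
    rw [Real.map_volume_mul_left (by simp [hpi.ne'])]
    exact Measure.smul_absolutelyContinuous
  filter_upwards [hq.ae u.2] with w hw hlt
  have h2 : hat (u : L2C) (-(2 * Real.pi) * w) = (𝓕 (u : L2C) : L2C) w := by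
    unfold hat
    congr 1
    field_simp
  rw [← h2]
  apply hw
  intro hmem
  have h3 := abs_le.mpr hmem
  rw [abs_mul, abs_neg, abs_of_pos (by positivity : 0 < 2 * Real.pi)] at h3
  exact absurd hlt (not_lt.mpr h3)

/-- Band-limited functions have a derivative in `L²`. -/
theorem exists_isL2Deriv {h : ℝ} (u : BL h) : ∃ w : L2C, IsL2Deriv (u : L2C) w := by
  set v : L2C := 𝓕 (u : L2C) with hv
  have hmeas : AEStronglyMeasurable (fun w : ℝ => (2 * Real.pi * Complex.I) * ((w : ℂ) * v w))
      volume :=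
    ((Complex.continuous_ofReal.aestronglyMeasurable).mul (Lp.aestronglyMeasurable v)).const_mul _
  have hq : MemLp (fun w : ℝ => (2 * Real.pi * Complex.I) * ((w : ℂ) * v w)) 2 volume := by
    refine (Lp.memLp v).of_le_mul (c := |Real.pi / h|) hmeas ?_
    filter_upwards [fourier_eq_zero_of_mem_BL u] with w hw
    by_cases hlt : Real.pi / h < 2 * Real.pi * |w|
    · rw [hw hlt]; simp
    · have h1 : 2 * Real.pi * |w| ≤ |Real.pi / h| := (not_lt.mp hlt).trans (le_abs_self _)
      have h2 : ‖(2 * Real.pi * Complex.I) * ((w : ℂ) * v w)‖ = 2 * Real.pi * |w| * ‖v w‖ := by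
        simp [abs_of_pos Real.pi_pos]
        ring
      rw [h2]
      gcongr
  refine ⟨𝓕⁻ (hq.toLp _ : L2C), ?_⟩
  unfold IsL2Deriv
  rw [derivCLM_eq_lineDeriv]
  have key : 𝓕 (LineDeriv.lineDerivOp (1 : ℝ) (((u : L2C)) : 𝓢'(ℝ, ℂ)))
      = 𝓕 (((𝓕⁻ (hq.toLp _ : L2C) : L2C)) : 𝓢'(ℝ, ℂ)) := by
    rw [TemperedDistribution.fourier_lineDerivOp_eq, Lp.fourier_toTemperedDistribution_eq,
      Lp.fourier_toTemperedDistribution_eq, FourierTransform.fourier_fourierInv_eq]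
    ext g
    have hg : (fun x : ℝ => Complex.ofReal (inner ℝ x (1 : ℝ))).HasTemperateGrowth := by fun_prop
    simp only [Lp.toTemperedDistribution_apply, TemperedDistribution.smulLeftCLM_apply_apply,
      _root_.smul_apply, smul_eq_mul]
    rw [← integral_const_mul]
    apply integral_congr_ae
    filter_upwards [hq.coeFn_toLp] with x hx
    rw [hx, SchwartzMap.smulLeftCLM_apply_apply hg]
    simp [hv]
    ring
  have := congrArg (fun T : 𝓢'(ℝ, ℂ) => 𝓕⁻ T) key
  simpa using this

/-- The derivative `∂ₓ u` of a band-limited function `u`. -/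
def BL.deriv {h : ℝ} (u : BL h) : L2C := (exists_isL2Deriv u).choose

theorem BL.isL2Deriv_deriv {h : ℝ} (u : BL h) : IsL2Deriv (u : L2C) (BL.deriv u) :=
  (exists_isL2Deriv u).choose_spec

/-- The real scalar product `⟨u, v⟩ = ∫ Re (u(x) conj v(x)) dx` of `L²(ℝ; ℂ)`. -/
def realInner (u v : L2C) : ℝ := ∫ x : ℝ, ((u x) * (starRingEnd ℂ) (v x)).re

/-- The `H¹(ℝ)` norm of a band-limited function. -/
def BL.h1Norm {h : ℝ} (u : BL h) : ℝ := Real.sqrt (‖(u : L2C)‖ ^ 2 + ‖BL.deriv u‖ ^ 2)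

/-- The homogeneous Hamiltonian
`H_h(u) = ½ ∫ |(u(x+h) - u(x)) / h|² dx - ¼ ‖u‖_{L⁴}⁴` on `BL²_h`. -/
def hamiltonian (h : ℝ) (u : BL h) : ℝ :=
  (1 / 2) * (∫ x : ℝ, ‖((u : L2C) (x + h) - (u : L2C) x) / (h : ℂ)‖ ^ 2)
    - (1 / 4) * (∫ x : ℝ, ‖(u : L2C) x‖ ^ 4)

/-- The Lagrange function
`L_ξ^h(u) = H_h(u) + (ξ₁/2) ‖u‖²_{L²} + (ξ₂/2) ⟨i ∂ₓ u, u⟩_{L²}` on `BL²_h`. -/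
def lagrangian (h : ℝ) (ξ : ℝ × ℝ) (u : BL h) : ℝ :=
  hamiltonian h u + (ξ.1 / 2) * ‖(u : L2C)‖ ^ 2
    + (ξ.2 / 2) * realInner (Complex.I • BL.deriv u) (u : L2C)

/-- `u` is a critical point of `L_ξ^h`: the Fréchet differential of `L_ξ^h : BL²_h → ℝ` at `u`,
over the reals, exists and vanishes. -/
def IsCriticalPoint (h : ℝ) (ξ : ℝ × ℝ) (u : BL h) : Prop :=
  HasFDerivAt (𝕜 := ℝ) (lagrangian h ξ) (0 : BL h →L[ℝ] ℝ) u

end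

noncomputable section

/-! Write `f` for the Fourier transform of `u`, in the normalisation with `2π` in the exponent. By
Plancherel the quadratic part of the Lagrange function is a multiplier form with real symbol `symbol
h ξ`, so a critical point satisfies, on the frequency band, `symbol · f = f * f * conj f(-·)`
(`symbol_mul_eq_cubicConv`). As `h → 0` the symbol tends to `ω² - ξ₂ω + ξ₁ = (ω - ξ₂/2)² + ξ₁ -
(ξ₂/2)²` with `ω = 2πw`. Compactness of the closure of `Ω` then yields the lower bound `α(1 + w²)`,
uniform in `ξ` and in small `h` (`exists_le_symbol`). Hence `F = |f|` satisfies `(1 + w²) F ≤ κ F *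
F * F(-·)` with `κ = 1/α`.

Decay follows from this inequality alone. The weight `e^{ε|w|}` passes through the triple
convolution, and the factor `1 + w²` pays for one factor `|w|`, so the moment `m(ε) = ∫ e^{ε|w|} F`
obeys `m(ε) ≤ m(0) + εκ m(ε)³`. Since `F` has bounded support, `m(ε)` cannot jump, and a continuity
argument keeps it below `A + 1` for `ε` small in terms of `κ` and `A` only, where `A` bounds the
`L¹` norm (`lintegral_expWeight_mul_le_add_one`). The size of the support, which blows up as `h →
0`, only affects the number of steps. Feeding the weighted bounds back into the inequality gives
pointwise decay (`le_exp_of_le_tripleConv`). -/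

/-! ### Inverse Fourier transform and Plancherel on `L¹ ∩ L²` -/

theorem integral_smul_fourierInv_eq (f g : ℝ → ℂ) (hf : Integrable f) (hg : Integrable g) :
    ∫ x, 𝓕⁻ f x • g x = ∫ x, f x • 𝓕⁻ g x := by
  have h := VectorFourier.integral_fourierIntegral_smul_eq_flip (e := Real.fourierChar)
    (μ := (volume : Measure ℝ)) (ν := (volume : Measure ℝ)) (L := -innerₗ ℝ)
    Real.continuous_fourierChar (by simp; fun_prop) hf hg
  convert h using 1
  · simp [VectorFourier.fourierIntegral, Real.fourierInv_eq]
  · simp [VectorFourier.fourierIntegral, Real.fourierInv_eq, mul_comm]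

theorem continuous_fourierInv {f : ℝ → ℂ} (hf : Integrable f) : Continuous (𝓕⁻ f) := by
  have h : Continuous (𝓕 f) := VectorFourier.fourierIntegral_continuous
    Real.continuous_fourierChar (by simp; fun_prop) hf
  have h2 : 𝓕⁻ f = fun x => 𝓕 f (-x) := funext (Real.fourierInv_eq_fourier_neg f)
  rw [h2]
  fun_prop

theorem norm_fourierInv_le (f : ℝ → ℂ) (x : ℝ) : ‖𝓕⁻ f x‖ ≤ ∫ w, ‖f w‖ := by
  rw [Real.fourierInv_eq]
  refine (norm_integral_le_integral_norm _).trans_eq ?_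
  simp

/-- On `L¹ ∩ L²` the inverse Fourier transform of `L²` is given by the Fourier integral. -/
theorem fourierInv_toLp_ae_eq {f : ℝ → ℂ} (hf : Integrable f) (hf2 : MemLp f 2) :
    ((𝓕⁻ (hf2.toLp f) : L2C) : ℝ → ℂ) =ᵐ[volume] 𝓕⁻ f := by
  apply ae_eq_of_integral_contDiff_smul_eq
  · exact (Lp.memLp _).locallyIntegrable (by norm_num)
  · exact (continuous_fourierInv hf).locallyIntegrable
  · intro g hg hgc
    have hg₁ : HasCompactSupport (Complex.ofRealCLM ∘ g) := hgc.comp_left rfl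
    have hg₂ : ContDiff ℝ (⊤ : ℕ∞) (Complex.ofRealCLM ∘ g) := by fun_prop
    set φ : 𝓢(ℝ, ℂ) := hg₁.toSchwartzMap hg₂ with hφ
    have hφx : ∀ x, φ x = (g x : ℂ) := fun x => rfl
    have h1 : ((𝓕⁻ (hf2.toLp f) : L2C) : 𝓢'(ℝ, ℂ)) φ
        = ((hf2.toLp f : L2C) : 𝓢'(ℝ, ℂ)) (𝓕⁻ φ) := by
      rw [← Lp.fourierInv_toTemperedDistribution_eq, TemperedDistribution.fourierInv_apply]
    rw [Lp.toTemperedDistribution_apply, Lp.toTemperedDistribution_apply] at h1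
    have h2 := integral_smul_fourierInv_eq φ f φ.integrable hf
    have h3 : ∫ x, (𝓕⁻ φ : 𝓢(ℝ, ℂ)) x • (hf2.toLp f : L2C) x = ∫ x, 𝓕⁻ (φ : ℝ → ℂ) x • f x := by
      apply integral_congr_ae
      filter_upwards [hf2.coeFn_toLp] with x hx
      rw [hx, SchwartzMap.fourierInv_coe]
    rw [h3, h2] at h1
    simpa [hφx] using h1

theorem memLp_fourierInv {f : ℝ → ℂ} (hf : Integrable f) (hf2 : MemLp f 2) :
    MemLp (𝓕⁻ f) 2 :=
  (memLp_congr_ae (fourierInv_toLp_ae_eq hf hf2)).1 (Lp.memLp _)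

theorem inner_L2_eq (u v : L2C) : inner ℂ u v = ∫ x, v x * (starRingEnd ℂ) (u x) := by
  rw [L2.inner_def]
  rfl

theorem inner_fourierInv (u v : L2C) : inner ℂ (𝓕⁻ u : L2C) (𝓕⁻ v : L2C) = inner ℂ u v :=
  (Lp.fourierTransformₗᵢ ℝ ℂ).symm.inner_map_map u v

theorem integral_fourierInv_mul_conj {f g : ℝ → ℂ} (hf : Integrable f) (hf2 : MemLp f 2)
    (hg : Integrable g) (hg2 : MemLp g 2) :
    ∫ x, 𝓕⁻ f x * (starRingEnd ℂ) (𝓕⁻ g x) = ∫ w, f w * (starRingEnd ℂ) (g w) := by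
  have h := inner_fourierInv (hg2.toLp g) (hf2.toLp f)
  rw [inner_L2_eq, inner_L2_eq] at h
  convert h using 1
  · apply integral_congr_ae
    filter_upwards [fourierInv_toLp_ae_eq hf hf2, fourierInv_toLp_ae_eq hg hg2] with x h1 h2
    rw [h1, h2]
  · apply integral_congr_ae
    filter_upwards [hf2.coeFn_toLp, hg2.coeFn_toLp] with x h1 h2
    rw [h1, h2]

theorem integral_norm_sq_fourierInv {f : ℝ → ℂ} (hf : Integrable f) (hf2 : MemLp f 2) :
    ∫ x, ‖𝓕⁻ f x‖ ^ 2 = ∫ w, ‖f w‖ ^ 2 := by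
  have h := integral_fourierInv_mul_conj hf hf2 hf hf2
  simp_rw [Complex.mul_conj, Complex.normSq_eq_norm_sq] at h
  rw [integral_complex_ofReal, integral_complex_ofReal] at h
  exact_mod_cast h

theorem norm_sq_L2_eq (u : L2C) : ‖u‖ ^ 2 = ∫ x, ‖u x‖ ^ 2 := by
  have h := inner_L2_eq u u
  simp_rw [Complex.mul_conj, Complex.normSq_eq_norm_sq] at h
  rw [integral_complex_ofReal, inner_self_eq_norm_sq_to_K] at h
  exact Complex.ofReal_injective (by push_cast; exact h)

theorem fourierInv_add_right (f : ℝ → ℂ) (x h : ℝ) :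
    𝓕⁻ f (x + h) = 𝓕⁻ (fun w => Complex.exp ((2 * Real.pi * (w * h) : ℝ) * Complex.I) * f w) x := by
  simp only [Real.fourierInv_eq', smul_eq_mul, ← mul_assoc, ← Complex.exp_add]
  congr with w
  refine congrArg (· * f w) (congrArg Complex.exp ?_)
  simp
  ring

theorem conj_fourierInv (f : ℝ → ℂ) (x : ℝ) :
    (starRingEnd ℂ) (𝓕⁻ f x) = 𝓕⁻ (fun w => (starRingEnd ℂ) (f (-w))) x := by
  rw [Real.fourierInv_eq', Real.fourierInv_eq', ← integral_conj,
    ← integral_neg_eq_self]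
  simp [← Complex.exp_conj, map_ofNat]

theorem fourierInv_mul {f g : ℝ → ℂ} (hf : Integrable f) (hg : Integrable g) (x : ℝ) :
    𝓕⁻ f x * 𝓕⁻ g x = 𝓕⁻ (convolution f g (ContinuousLinearMap.mul ℂ ℂ) volume) x := by
  simp only [Real.fourierInv_eq_fourier_neg]
  exact (Real.fourier_mul_convolution_eq hf hg _).symm

/-! ### The cubic nonlinearity and triple convolutions -/

/-- The function whose inverse Fourier transform is `|u|² u` when that of `f` is `u`. -/
def cubicConv (f : ℝ → ℂ) : ℝ → ℂ :=
  convolution f (convolution f (fun w => (starRingEnd ℂ) (f (-w))) (ContinuousLinearMap.mul ℂ ℂ)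
    volume) (ContinuousLinearMap.mul ℂ ℂ) volume

theorem integrable_conj_comp_neg {f : ℝ → ℂ} (hf : Integrable f) :
    Integrable fun w => (starRingEnd ℂ) (f (-w)) :=
  (Complex.conjLIE.toContinuousLinearEquiv.integrable_comp_iff (φ := fun w => f (-w))).2 hf.comp_neg

theorem integrable_cubicConv {f : ℝ → ℂ} (hf : Integrable f) : Integrable (cubicConv f) :=
  hf.integrable_convolution _ (hf.integrable_convolution _ (integrable_conj_comp_neg hf))

theorem fourierInv_cubicConv {f : ℝ → ℂ} (hf : Integrable f) (x : ℝ) :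
    𝓕⁻ (cubicConv f) x = (‖𝓕⁻ f x‖ ^ 2 : ℝ) * 𝓕⁻ f x := by
  have hc := integrable_conj_comp_neg hf
  rw [cubicConv, ← fourierInv_mul hf (hf.integrable_convolution _ hc), ← fourierInv_mul hf hc,
    ← conj_fourierInv, Complex.mul_conj, Complex.normSq_eq_norm_sq]
  ring

theorem enorm_cubicConv_le (f : ℝ → ℂ) (w : ℝ) :
    ‖cubicConv f w‖ₑ ≤ ∫⁻ a, ∫⁻ b, ‖f a‖ₑ * (‖f b‖ₑ * ‖f (a + b - w)‖ₑ) := by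
  rw [cubicConv, convolution_def]
  refine (enorm_integral_le_lintegral_enorm _).trans (lintegral_mono fun a => ?_)
  simp only [ContinuousLinearMap.mul_apply', enorm_mul]
  refine le_trans ?_ (le_of_eq (lintegral_const_mul' _ _ (by simp)).symm)
  gcongr
  rw [convolution_def]
  refine (enorm_integral_le_lintegral_enorm _).trans (lintegral_mono fun b => ?_)
  simp only [ContinuousLinearMap.mul_apply', enorm_mul]
  gcongr
  refine le_of_eq ?_
  rw [RCLike.enorm_conj]
  congr 2
  ring

/-- The convolution `F * F * F(-·)` of a nonnegative function. -/
def tripleConv (F : ℝ → ℝ≥0∞) (w : ℝ) : ℝ≥0∞ := ∫⁻ a, ∫⁻ b, F a * (F b * F (a + b - w))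

/-- Tonelli: for fixed `a`, `b` the integral in `w` of `F (a + b - w)` is the total mass, by
invariance of the measure. -/
theorem lintegral_tripleConv {F : ℝ → ℝ≥0∞} (hF : Measurable F) :
    ∫⁻ w, tripleConv F w = (∫⁻ a, F a) ^ 3 := by
  unfold tripleConv
  rw [lintegral_lintegral_swap (by fun_prop)]
  have h : ∀ a, ∫⁻ w, ∫⁻ b, F a * (F b * F (a + b - w)) = F a * (∫⁻ b, F b) ^ 2 := by
    intro a
    rw [lintegral_lintegral_swap (by fun_prop)]
    have h1 : ∀ b, ∫⁻ w, F a * (F b * F (a + b - w)) = F a * (F b * ∫⁻ w, F w) := by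
      intro b
      rw [lintegral_const_mul _ (by fun_prop), lintegral_const_mul _ (by fun_prop),
        lintegral_sub_left_eq_self F (a + b)]
    simp_rw [h1]
    rw [lintegral_const_mul _ (by fun_prop), lintegral_mul_const _ hF, sq]
  simp_rw [h]
  rw [lintegral_mul_const _ hF]
  ring

/-- The integral in `b` is bounded by `xy ≤ x² + y²` and translation invariance; the factor `2`,
lost against Cauchy–Schwarz, is harmless. -/
theorem tripleConv_le {F : ℝ → ℝ≥0∞} (hF : Measurable F) (w : ℝ) :
    tripleConv F w ≤ 2 * (∫⁻ a, F a) * ∫⁻ a, F a ^ 2 := by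
  have h : ∀ a, ∫⁻ b, F a * (F b * F (a + b - w)) ≤ F a * (2 * ∫⁻ b, F b ^ 2) := by
    intro a
    rw [lintegral_const_mul _ (by fun_prop)]
    gcongr
    calc ∫⁻ b, F b * F (a + b - w) ≤ ∫⁻ b, (F b ^ 2 + F (b + (a - w)) ^ 2) := by
          refine lintegral_mono fun b => ?_
          have h2 : a + b - w = b + (a - w) := by ring
          rw [h2]
          rcases le_total (F b) (F (b + (a - w))) with h3 | h3
          · refine le_trans ?_ le_add_self
            rw [sq]; gcongr
          · refine le_trans ?_ le_self_add
            rw [sq]; gcongr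
      _ = 2 * ∫⁻ b, F b ^ 2 := by
          rw [lintegral_add_left (by fun_prop),
            lintegral_add_right_eq_self (fun b => F b ^ 2) (a - w), two_mul]
  refine (lintegral_mono h).trans_eq ?_
  rw [lintegral_mul_const _ hF]
  ring

/-! ### Exponential weights -/

/-- The exponential weight `e^{ε|w|}`. -/
def expWeight (ε w : ℝ) : ℝ≥0∞ := ENNReal.ofReal (Real.exp (ε * |w|))

theorem measurable_expWeight (ε : ℝ) : Measurable (expWeight ε) := by
  unfold expWeight
  fun_prop

theorem expWeight_mul (ε δ w : ℝ) : expWeight ε w * expWeight δ w = expWeight (ε + δ) w := by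
  rw [expWeight, expWeight, expWeight, ← ENNReal.ofReal_mul (Real.exp_pos _).le, ← Real.exp_add,
    add_mul]

/-- Since `w = a + b - (a + b - w)`, the triangle inequality bounds the weight at `w` by the product
of the weights at the three arguments. -/
theorem expWeight_mul_tripleConv_le {F : ℝ → ℝ≥0∞} {ε : ℝ} (hε : 0 ≤ ε) (w : ℝ) :
    expWeight ε w * tripleConv F w ≤ tripleConv (fun a => expWeight ε a * F a) w := by
  unfold tripleConv
  have hne : expWeight ε w ≠ ∞ := ENNReal.ofReal_ne_top
  rw [← lintegral_const_mul' _ _ hne]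
  refine lintegral_mono fun a => ?_
  rw [← lintegral_const_mul' _ _ hne]
  refine lintegral_mono fun b => ?_
  have h : expWeight ε w ≤ expWeight ε a * (expWeight ε b * expWeight ε (a + b - w)) := by
    unfold expWeight
    rw [← ENNReal.ofReal_mul (Real.exp_pos _).le, ← ENNReal.ofReal_mul (Real.exp_pos _).le,
      ← Real.exp_add, ← Real.exp_add]
    refine ENNReal.ofReal_le_ofReal (Real.exp_le_exp.2 ?_)
    have h1 : |w| ≤ |a| + |b| + |a + b - w| := by
      have := abs_sub (a + b) (a + b - w)
      have := abs_add_le a b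
      rw [show a + b - (a + b - w) = w by ring] at *
      linarith
    nlinarith
  calc _ ≤ expWeight ε a * (expWeight ε b * expWeight ε (a + b - w)) *
        (F a * (F b * F (a + b - w))) := by gcongr
    _ = _ := by ring

/-- Quantitative continuity of the exponential moment in its rate; this is the only use of the
bounded support. -/
theorem lintegral_expWeight_mul_add_le {F : ℝ → ℝ≥0∞} {R : ℝ}
    (hR : ∀ w, R < |w| → F w = 0) (ε : ℝ) {δ : ℝ} (hδ : 0 ≤ δ) :
    ∫⁻ w, expWeight (ε + δ) w * F w
      ≤ ENNReal.ofReal (Real.exp (δ * R)) * ∫⁻ w, expWeight ε w * F w := by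
  rw [← lintegral_const_mul' _ _ ENNReal.ofReal_ne_top]
  refine lintegral_mono fun w => ?_
  by_cases hw : R < |w|
  · simp [hR w hw]
  · dsimp only
    rw [add_comm ε, ← expWeight_mul, mul_assoc]
    gcongr
    unfold expWeight
    gcongr
    exact not_lt.1 hw

/-! ### Bootstrap from the cubic inequality to exponential decay -/

section Decay

variable {F : ℝ → ℝ≥0∞} {κ A : ℝ}

/-- From `e^s ≤ 1 + s e^s` with `s = ε|w|` and `|w| ≤ 1 + w²`: the term carrying `1 + w²` is
absorbed by `hT`, and the factor `ε` survives as the small parameter. -/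
theorem lintegral_expWeight_mul_le (hF : Measurable F)
    (hT : ∀ᵐ w, ENNReal.ofReal (1 + w ^ 2) * F w ≤ ENNReal.ofReal κ * tripleConv F w)
    {ε : ℝ} (hε : 0 ≤ ε) :
    ∫⁻ w, expWeight ε w * F w
      ≤ (∫⁻ w, F w) + ENNReal.ofReal (ε * κ) * (∫⁻ w, expWeight ε w * F w) ^ 3 := by
  have hm := measurable_expWeight ε
  have hG : Measurable fun w => expWeight ε w * F w := by fun_prop
  rw [← lintegral_tripleConv hG, ← lintegral_const_mul' _ _ ENNReal.ofReal_ne_top,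
    ← lintegral_add_left hF]
  apply lintegral_mono_ae
  filter_upwards [hT] with w hw
  have h1 : expWeight ε w ≤ 1 + ENNReal.ofReal ε * ENNReal.ofReal (1 + w ^ 2) * expWeight ε w := by
    unfold expWeight
    rw [← ENNReal.ofReal_mul hε, ← ENNReal.ofReal_mul (by positivity), ← ENNReal.ofReal_one,
      ← ENNReal.ofReal_add zero_le_one (by positivity)]
    apply ENNReal.ofReal_le_ofReal
    have h2 := Real.add_one_le_exp (-(ε * |w|))
    rw [Real.exp_neg] at h2
    have h3 := Real.exp_pos (ε * |w|)
    have h4 : |w| ≤ 1 + w ^ 2 := by rw [← sq_abs]; nlinarith [sq_nonneg (|w| - 1)]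
    have h5 : (-(ε * |w|) + 1) * Real.exp (ε * |w|) ≤ 1 := by
      calc _ ≤ (Real.exp (ε * |w|))⁻¹ * Real.exp (ε * |w|) := by gcongr
        _ = 1 := inv_mul_cancel₀ h3.ne'
    have h6 : ε * |w| * Real.exp (ε * |w|) ≤ ε * (1 + w ^ 2) * Real.exp (ε * |w|) := by gcongr
    linarith
  calc expWeight ε w * F w
      ≤ (1 + ENNReal.ofReal ε * ENNReal.ofReal (1 + w ^ 2) * expWeight ε w) * F w := by gcongr
    _ = F w + ENNReal.ofReal ε * expWeight ε w * (ENNReal.ofReal (1 + w ^ 2) * F w) := by ring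
    _ ≤ F w + ENNReal.ofReal ε * expWeight ε w * (ENNReal.ofReal κ * tripleConv F w) := by gcongr
    _ = F w + ENNReal.ofReal (ε * κ) * (expWeight ε w * tripleConv F w) := by
        rw [ENNReal.ofReal_mul hε]; ring
    _ ≤ _ := by
        gcongr
        exact expWeight_mul_tripleConv_le hε w

/-- Bootstrap bound for exponential moments of a compactly supported function. -/
theorem lintegral_expWeight_mul_le_add_one (hF : Measurable F) {R : ℝ}
    (hR : ∀ w, R < |w| → F w = 0) (hκ : 0 < κ)
    (hT : ∀ᵐ w, ENNReal.ofReal (1 + w ^ 2) * F w ≤ ENNReal.ofReal κ * tripleConv F w)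
    (hA : 0 ≤ A) (hFA : ∫⁻ w, F w ≤ ENNReal.ofReal A)
    {ε : ℝ} (hε : 0 ≤ ε) (hεA : ε * κ * (2 * (A + 1)) ^ 3 ≤ 1) :
    ∫⁻ w, expWeight ε w * F w ≤ ENNReal.ofReal (A + 1) := by
  -- The rate goes from `0` to `ε` in `N` equal steps, `N` being large enough for each step to at
  -- most double the moment.
  obtain ⟨N, hN⟩ := exists_nat_gt (|ε * R| / Real.log 2)
  have hlog := Real.log_pos one_lt_two
  have hN0 : (0 : ℝ) < N := lt_of_le_of_lt (by positivity) hN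
  have hstep : Real.exp (ε / N * R) ≤ 2 := by
    rw [← Real.le_log_iff_exp_le two_pos, div_mul_eq_mul_div, div_le_iff₀ hN0]
    rw [div_lt_iff₀ hlog] at hN
    have := le_abs_self (ε * R)
    linarith
  have key : ∀ k : ℕ, k ≤ N →
      ∫⁻ w, expWeight (k * (ε / N)) w * F w ≤ ENNReal.ofReal (A + 1) := by
    intro k
    induction k with
    | zero =>
      intro _
      simp only [Nat.cast_zero, zero_mul, expWeight, Real.exp_zero, ENNReal.ofReal_one, one_mul]
      exact hFA.trans (ENNReal.ofReal_le_ofReal (by linarith))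
    | succ k ih =>
      intro hk
      have h1 := ih (by omega)
      set η : ℝ := ((k + 1 : ℕ) : ℝ) * (ε / N) with hη
      have hη0 : 0 ≤ η := by positivity
      have hηε : η ≤ ε := by
        have : ((k + 1 : ℕ) : ℝ) ≤ N := by exact_mod_cast hk
        rw [hη, mul_div_assoc', div_le_iff₀ hN0, mul_comm ε]
        gcongr
      -- The crude bound `2(A + 1)` from the previous step makes the cubic term at most `1` by
      -- `hεA`, which restores the bound `A + 1`.
      have h2 : ∫⁻ w, expWeight η w * F w ≤ ENNReal.ofReal (2 * (A + 1)) := by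
        have h3 := lintegral_expWeight_mul_add_le hR (k * (ε / N)) (δ := ε / N) (by positivity)
        rw [show (k : ℝ) * (ε / N) + ε / N = η by rw [hη]; push_cast; ring] at h3
        refine h3.trans ?_
        rw [ENNReal.ofReal_mul zero_le_two]
        gcongr
      refine (lintegral_expWeight_mul_le hF hT hη0).trans ?_
      calc _ ≤ ENNReal.ofReal A + ENNReal.ofReal (ε * κ) * (ENNReal.ofReal (2 * (A + 1))) ^ 3 := by
            gcongr
        _ ≤ _ := by
            rw [← ENNReal.ofReal_pow (by positivity), ← ENNReal.ofReal_mul (by positivity),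
              ← ENNReal.ofReal_add hA (by positivity)]
            apply ENNReal.ofReal_le_ofReal
            linarith
  have h := key N le_rfl
  rwa [mul_div_cancel₀ _ hN0.ne'] at h

/-- A compactly supported solution of `(1 + w²) F ≤ κ F * F * F(-·)` decays exponentially, with
constants depending only on `κ` and on bounds for the `L¹` and `L²` norms. -/
theorem le_exp_of_le_tripleConv (hF : Measurable F) {R S : ℝ}
    (hR : ∀ w, R < |w| → F w = 0) (hκ : 0 < κ)
    (hT : ∀ᵐ w, ENNReal.ofReal (1 + w ^ 2) * F w ≤ ENNReal.ofReal κ * tripleConv F w)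
    (hA : 0 ≤ A) (hFA : ∫⁻ w, F w ≤ ENNReal.ofReal A)
    (hS : 0 ≤ S) (hFS : ∫⁻ w, F w ^ 2 ≤ ENNReal.ofReal S)
    {ε : ℝ} (hε : 0 ≤ ε) (hεA : ε * κ * (2 * (A + 1)) ^ 3 ≤ 1) :
    ∀ᵐ w, F w ≤ ENNReal.ofReal
      (4 * κ ^ 2 * A * S * (A + 1) ^ 2 * Real.exp (-(ε / 2) * |w|)) := by
  have hT' : ∀ᵐ w, F w ≤ ENNReal.ofReal κ * tripleConv F w := by
    filter_upwards [hT] with w hw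
    refine le_trans ?_ hw
    nth_rewrite 1 [← one_mul (F w)]
    gcongr
    rw [← ENNReal.ofReal_one]
    exact ENNReal.ofReal_le_ofReal (by nlinarith [sq_nonneg w])
  have hsup : ∀ᵐ w, F w ≤ ENNReal.ofReal (2 * κ * A * S) := by
    filter_upwards [hT'] with w hw
    refine hw.trans ?_
    calc _ ≤ ENNReal.ofReal κ * (2 * (ENNReal.ofReal A) * ENNReal.ofReal S) := by
          gcongr
          refine (tripleConv_le hF w).trans ?_
          gcongr
      _ = ENNReal.ofReal (2 * κ * A * S) := by
          rw [ENNReal.ofReal_mul (by positivity), ENNReal.ofReal_mul (by positivity),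
            ENNReal.ofReal_mul (by positivity)]
          simp only [ENNReal.ofReal_ofNat]
          ring
  have hm := measurable_expWeight (ε / 2)
  have hG : Measurable fun w => expWeight (ε / 2) w * F w := by fun_prop
  have h1 : ∫⁻ w, expWeight (ε / 2) w * F w ≤ ENNReal.ofReal (A + 1) := by
    refine lintegral_expWeight_mul_le_add_one hF hR hκ hT hA hFA (by positivity) (le_trans ?_ hεA)
    gcongr
    linarith
  -- Squaring the half weight gives the full weight: the weighted `L²` norm is controlled by the sup
  -- of `F` times the moment at rate `ε`. This is why the final rate is `ε / 2`.
  have h2 : ∫⁻ w, (expWeight (ε / 2) w * F w) ^ 2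
      ≤ ENNReal.ofReal (2 * κ * A * S) * ENNReal.ofReal (A + 1) := by
    calc _ ≤ ∫⁻ w, ENNReal.ofReal (2 * κ * A * S) * (expWeight ε w * F w) := by
          apply lintegral_mono_ae
          filter_upwards [hsup] with w hw
          have : expWeight ε w = expWeight (ε / 2) w * expWeight (ε / 2) w := by
            rw [expWeight_mul, add_halves]
          calc _ = F w * (expWeight ε w * F w) := by rw [this]; ring
            _ ≤ _ := by gcongr
      _ ≤ _ := by
          rw [lintegral_const_mul' _ _ ENNReal.ofReal_ne_top]
          gcongr
          exact lintegral_expWeight_mul_le_add_one hF hR hκ hT hA hFA hε hεA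
  filter_upwards [hT'] with w hw
  have h3 : expWeight (ε / 2) w * F w ≤ ENNReal.ofReal (4 * κ ^ 2 * A * S * (A + 1) ^ 2) := by
    calc _ ≤ expWeight (ε / 2) w * (ENNReal.ofReal κ * tripleConv F w) := by gcongr
      _ = ENNReal.ofReal κ * (expWeight (ε / 2) w * tripleConv F w) := by ring
      _ ≤ ENNReal.ofReal κ * tripleConv (fun a => expWeight (ε / 2) a * F a) w := by
          gcongr
          exact expWeight_mul_tripleConv_le (by positivity) w
      _ ≤ ENNReal.ofReal κ * (2 * ENNReal.ofReal (A + 1) *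
            (ENNReal.ofReal (2 * κ * A * S) * ENNReal.ofReal (A + 1))) := by
          gcongr
          refine (tripleConv_le hG w).trans ?_
          gcongr
      _ = ENNReal.ofReal (κ * (2 * (A + 1) * (2 * κ * A * S * (A + 1)))) := by
          have hD : 0 ≤ 2 * κ * A * S := by positivity
          generalize 2 * κ * A * S = D at hD
          rw [ENNReal.ofReal_mul hκ.le, ENNReal.ofReal_mul (p := 2 * (A + 1)) (by positivity),
            ENNReal.ofReal_mul zero_le_two, ENNReal.ofReal_mul hD, ENNReal.ofReal_ofNat]
      _ = _ := by congr 1; ring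
  calc F w = expWeight (-(ε / 2)) w * (expWeight (ε / 2) w * F w) := by
        rw [← mul_assoc, expWeight_mul]
        simp [expWeight]
    _ ≤ expWeight (-(ε / 2)) w * ENNReal.ofReal (4 * κ ^ 2 * A * S * (A + 1) ^ 2) := by gcongr
    _ = _ := by
        rw [expWeight, ← ENNReal.ofReal_mul (Real.exp_pos _).le]
        congr 1; ring

end Decay

/-! ### Band-limited functions described by their transforms -/

/-- Square integrable functions supported in the frequency band `[-1/(2h), 1/(2h)]`. -/
structure IsBand (h : ℝ) (f : ℝ → ℂ) : Prop where
  measurable : Measurable f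
  memLp : MemLp f 2
  eq_zero : ∀ w, Real.pi / h < 2 * Real.pi * |w| → f w = 0

/-- The frequency band `[-1/(2h), 1/(2h)]`. -/
def freqBand (h : ℝ) : Set ℝ := {w | 2 * Real.pi * |w| ≤ Real.pi / h}

theorem mem_freqBand {h w : ℝ} : w ∈ freqBand h ↔ 2 * Real.pi * |w| ≤ Real.pi / h := Iff.rfl

theorem notMem_freqBand {h w : ℝ} : w ∉ freqBand h ↔ Real.pi / h < 2 * Real.pi * |w| := by
  rw [mem_freqBand, not_le]

namespace IsBand

variable {h : ℝ} {f g : ℝ → ℂ}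

theorem eq_zero_of_lt (hf : IsBand h f) {w : ℝ} (hw : |Real.pi / h| < |w|) : f w = 0 := by
  apply hf.eq_zero
  have := le_abs_self (Real.pi / h)
  have := abs_nonneg w
  nlinarith [Real.pi_gt_three]

theorem integrable (hf : IsBand h f) : Integrable f := by
  have hs : Function.support f ⊆ Set.Icc (-|Real.pi / h|) |Real.pi / h| := by
    intro w hw
    by_contra hc
    exact hw (hf.eq_zero_of_lt (by rwa [Set.mem_Icc, ← abs_le, not_le] at hc))
  rw [← integrableOn_iff_integrable_of_support_subset hs]
  exact (hf.memLp.restrict _).integrable one_le_two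

theorem add (hf : IsBand h f) (hg : IsBand h g) : IsBand h (f + g) where
  measurable := hf.measurable.add hg.measurable
  memLp := hf.memLp.add hg.memLp
  eq_zero w hw := by simp [hf.eq_zero w hw, hg.eq_zero w hw]

theorem smul (hf : IsBand h f) (t : ℝ) : IsBand h (t • f) where
  measurable := hf.measurable.const_smul t
  memLp := hf.memLp.const_smul t
  eq_zero w hw := by simp [hf.eq_zero w hw]

/-- Products with continuous functions stay in the band. -/
theorem continuous_mul (hf : IsBand h f) {m : ℝ → ℂ} (hm : Continuous m) :
    IsBand h (fun w => m w * f w) where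
  measurable := hm.measurable.mul hf.measurable
  memLp := by
    obtain ⟨C, hC⟩ := (isCompact_Icc (a := -|Real.pi / h|)
      (b := |Real.pi / h|)).exists_bound_of_continuousOn hm.continuousOn
    refine hf.memLp.of_le_mul (c := C) (hm.measurable.mul hf.measurable).aestronglyMeasurable
      (ae_of_all _ fun w => ?_)
    by_cases hw : |Real.pi / h| < |w|
    · simp [hf.eq_zero_of_lt hw]
    · rw [norm_mul]
      gcongr
      exact hC w (Set.mem_Icc.2 (abs_le.1 (not_lt.1 hw)))
  eq_zero w hw := by simp [hf.eq_zero w hw]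

theorem indicator {m : ℝ → ℂ} (hm : Measurable m) (hm2 : MemLp m 2) :
    IsBand h ((freqBand h).indicator m) := by
  have hs : MeasurableSet (freqBand h) :=
    measurableSet_le (by fun_prop) (by fun_prop)
  exact ⟨hm.indicator hs, hm2.indicator hs, fun w hw =>
    Set.indicator_of_notMem (notMem_freqBand.2 hw) _⟩

theorem fourierInv_mem_BL (hf : IsBand h f) : (𝓕⁻ (hf.memLp.toLp f) : L2C) ∈ BL h := by
  have h1 : ∀ᵐ ω : ℝ, (𝓕 (𝓕⁻ (hf.memLp.toLp f) : L2C) : L2C) (-ω / (2 * Real.pi))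
      = f (-ω / (2 * Real.pi)) := by
    rw [FourierTransform.fourier_fourierInv_eq]
    exact quasiMeasurePreserving_hatScale.ae hf.memLp.coeFn_toLp
  have h0 := Real.pi_pos
  change ∀ᵐ ω : ℝ, ω ∉ Set.Icc (-(Real.pi / h)) (Real.pi / h) → _
  filter_upwards [h1] with ω h2 hω
  rw [hat, h2]
  apply hf.eq_zero
  rw [Set.mem_Icc, ← abs_le, not_le] at hω
  rw [abs_div, abs_neg, abs_of_pos (by positivity : 0 < 2 * Real.pi)]
  rwa [mul_div_cancel₀ _ (by positivity)]

/-- The band-limited function with a given transform. -/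
def toBL (hf : IsBand h f) : BL h := ⟨𝓕⁻ (hf.memLp.toLp f), hf.fourierInv_mem_BL⟩

theorem toBL_ae_eq (hf : IsBand h f) : ((hf.toBL : L2C) : ℝ → ℂ) =ᵐ[volume] 𝓕⁻ f :=
  fourierInv_toLp_ae_eq hf.integrable hf.memLp

theorem hat_toBL (hf : IsBand h f) :
    hat (hf.toBL : L2C) =ᵐ[volume] fun ω => f (-ω / (2 * Real.pi)) := by
  have h1 := quasiMeasurePreserving_hatScale.ae hf.memLp.coeFn_toLp
  filter_upwards [h1] with ω h2
  rw [← h2, hat, toBL, FourierTransform.fourier_fourierInv_eq]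

theorem toBL_add_smul (hf : IsBand h f) (hg : IsBand h g) (t : ℝ) :
    hf.toBL + t • hg.toBL = (hf.add (hg.smul t)).toBL := by
  apply Subtype.ext
  change (𝓕⁻ (hf.memLp.toLp f) : L2C) + t • (𝓕⁻ (hg.memLp.toLp g) : L2C) = 𝓕⁻ (_ : L2C)
  have h1 : t • (𝓕⁻ (hg.memLp.toLp g) : L2C) = 𝓕⁻ ((t : ℂ) • hg.memLp.toLp g : L2C) := by
    rw [FourierTransform.fourierInv_smul]
    rfl
  rw [h1, ← FourierTransform.fourierInv_add]
  rfl

end IsBand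

/-- The transform vanishes only almost everywhere off the band; truncating it by an indicator gives
a representative that vanishes there at every point. -/
theorem BL.exists_isBand {h : ℝ} (u : BL h) : ∃ f, ∃ hf : IsBand h f, u = hf.toBL := by
  have hm := (Lp.stronglyMeasurable (𝓕 (u : L2C) : L2C)).measurable
  have hf : IsBand h _ := IsBand.indicator hm (Lp.memLp (𝓕 (u : L2C) : L2C))
  refine ⟨_, hf, Subtype.ext ?_⟩
  have h1 : hf.memLp.toLp _ = (𝓕 (u : L2C) : L2C) := by
    apply Lp.ext
    filter_upwards [hf.memLp.coeFn_toLp, fourier_eq_zero_of_mem_BL u] with w h2 h3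
    rw [h2]
    by_cases hw : w ∈ freqBand h
    · exact Set.indicator_of_mem hw _
    · rw [h3 (notMem_freqBand.1 hw)]
      exact Set.indicator_of_notMem hw _
  change (u : L2C) = 𝓕⁻ (hf.memLp.toLp _)
  rw [h1, FourierTransform.fourierInv_fourier_eq]

theorem isL2Deriv_fourierInv {u : L2C} {q : ℝ → ℂ} (hq : MemLp q 2)
    (hqu : q =ᵐ[volume] fun w => (2 * Real.pi * Complex.I) * ((w : ℂ) * (𝓕 u : L2C) w)) :
    IsL2Deriv u (𝓕⁻ (hq.toLp q) : L2C) := by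
  unfold IsL2Deriv
  rw [derivCLM_eq_lineDeriv]
  have key : 𝓕 (LineDeriv.lineDerivOp (1 : ℝ) (u : 𝓢'(ℝ, ℂ)))
      = 𝓕 (((𝓕⁻ (hq.toLp _ : L2C) : L2C)) : 𝓢'(ℝ, ℂ)) := by
    rw [TemperedDistribution.fourier_lineDerivOp_eq, Lp.fourier_toTemperedDistribution_eq,
      Lp.fourier_toTemperedDistribution_eq, FourierTransform.fourier_fourierInv_eq]
    ext g
    have hg : (fun x : ℝ => Complex.ofReal (inner ℝ x (1 : ℝ))).HasTemperateGrowth := by fun_prop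
    simp only [Lp.toTemperedDistribution_apply, TemperedDistribution.smulLeftCLM_apply_apply,
      _root_.smul_apply, smul_eq_mul]
    rw [← integral_const_mul]
    apply integral_congr_ae
    filter_upwards [hq.coeFn_toLp, hqu] with x hx hx'
    rw [hx, hx', SchwartzMap.smulLeftCLM_apply_apply hg]
    simp
    ring
  have := congrArg (fun T : 𝓢'(ℝ, ℂ) => 𝓕⁻ T) key
  simpa using this

namespace IsBand

variable {h : ℝ} {f g : ℝ → ℂ}

theorem deriv (hf : IsBand h f) :
    IsBand h (fun w => (2 * Real.pi * Complex.I * (w : ℂ)) * f w) :=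
  hf.continuous_mul (by fun_prop)

/-- `BL.deriv` is an arbitrary choice, so it is identified through uniqueness of the distributional
derivative. -/
theorem deriv_toBL (hf : IsBand h f) :
    BL.deriv hf.toBL = (𝓕⁻ (hf.deriv.memLp.toLp _) : L2C) := by
  refine (BL.isL2Deriv_deriv _).unique (isL2Deriv_fourierInv _ ?_)
  have h1 : (𝓕 (hf.toBL : L2C) : L2C) = hf.memLp.toLp f := FourierTransform.fourier_fourierInv_eq _
  rw [h1]
  filter_upwards [hf.memLp.coeFn_toLp] with w hw
  rw [hw]
  ring

theorem norm_sq_toBL (hf : IsBand h f) : ‖(hf.toBL : L2C)‖ ^ 2 = ∫ w, ‖f w‖ ^ 2 := by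
  rw [norm_sq_L2_eq, ← integral_norm_sq_fourierInv hf.integrable hf.memLp]
  apply integral_congr_ae
  filter_upwards [hf.toBL_ae_eq] with x hx
  rw [hx]

theorem h1Norm_toBL_sq (hf : IsBand h f) :
    (BL.h1Norm hf.toBL) ^ 2 = ∫ w, (1 + (2 * Real.pi * w) ^ 2) * ‖f w‖ ^ 2 := by
  have h1 : ‖BL.deriv hf.toBL‖ ^ 2 = ∫ w, (2 * Real.pi * w) ^ 2 * ‖f w‖ ^ 2 := by
    have : BL.deriv hf.toBL = hf.deriv.toBL := hf.deriv_toBL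
    rw [this, hf.deriv.norm_sq_toBL]
    congr with w
    rw [norm_mul, mul_pow]
    congr 1
    simp [mul_pow]
  have h2 : Integrable fun w => ‖f w‖ ^ 2 :=
    (memLp_two_iff_integrable_sq_norm hf.measurable.aestronglyMeasurable).1 hf.memLp
  have h3 : Integrable fun w => (2 * Real.pi * w) ^ 2 * ‖f w‖ ^ 2 := by
    refine ((memLp_two_iff_integrable_sq_norm hf.deriv.measurable.aestronglyMeasurable).1
      hf.deriv.memLp).congr (ae_of_all _ fun w => ?_)
    simp [mul_pow]
  rw [BL.h1Norm, Real.sq_sqrt (by positivity), hf.norm_sq_toBL, h1, ← integral_add h2 h3]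
  congr with w
  ring_nf

theorem integrable_mul_re (hf : IsBand h f) (hg : IsBand h g) {m : ℝ → ℝ} (hm : Continuous m) :
    Integrable fun w => m w * (f w * (starRingEnd ℂ) (g w)).re := by
  have h1 := (hf.continuous_mul (m := fun w => (m w : ℂ)) (by fun_prop)).memLp.integrable_mul
    (hg.memLp.star)
  refine h1.re.congr (ae_of_all _ fun w => ?_)
  simp [mul_assoc]

end IsBand

/-! ### The Lagrange function as a Fourier multiplier form -/

theorem norm_exp_mul_I_sub_one_sq (θ : ℝ) :
    ‖Complex.exp (θ * Complex.I) - 1‖ ^ 2 = 2 - 2 * Real.cos θ := by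
  have h := Real.sin_sq_add_cos_sq θ
  rw [← Complex.normSq_eq_norm_sq, Complex.exp_mul_I, Complex.normSq_apply,
    ← Complex.ofReal_cos, ← Complex.ofReal_sin]
  simp only [Complex.sub_re, Complex.add_re, Complex.ofReal_re, Complex.mul_re, Complex.I_re,
    Complex.ofReal_im, Complex.I_im, Complex.one_re, Complex.sub_im, Complex.add_im,
    Complex.mul_im, Complex.one_im]
  linarith

/-- The Fourier symbol of the quadratic part of the Lagrange function. -/
def symbol (h : ℝ) (ξ : ℝ × ℝ) (w : ℝ) : ℝ :=
  (2 - 2 * Real.cos (2 * Real.pi * w * h)) / h ^ 2 + ξ.1 - 2 * Real.pi * ξ.2 * w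

theorem continuous_symbol (h : ℝ) (ξ : ℝ × ℝ) : Continuous (symbol h ξ) := by
  unfold symbol
  fun_prop

namespace IsBand

variable {h : ℝ} {f g : ℝ → ℂ}

theorem integral_sq_shift (hf : IsBand h f) :
    ∫ x : ℝ, ‖((hf.toBL : L2C) (x + h) - (hf.toBL : L2C) x) / (h : ℂ)‖ ^ 2
      = ∫ w, (2 - 2 * Real.cos (2 * Real.pi * w * h)) / h ^ 2 * (f w * (starRingEnd ℂ) (f w)).re := by
  have hs : IsBand h (fun w => ((Complex.exp ((2 * Real.pi * (w * h) : ℝ) * Complex.I) - 1) / h) * f w) :=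
    hf.continuous_mul (by fun_prop)
  have hs' : IsBand h (fun w => Complex.exp ((2 * Real.pi * (w * h) : ℝ) * Complex.I) * f w) :=
    hf.continuous_mul (by fun_prop)
  have h1 : ∀ x, (𝓕⁻ f (x + h) - 𝓕⁻ f x) / (h : ℂ) = 𝓕⁻ (fun w => ((Complex.exp
      ((2 * Real.pi * (w * h) : ℝ) * Complex.I) - 1) / h) * f w) x := by
    intro x
    rw [fourierInv_add_right]
    simp only [Real.fourierInv_eq_fourier_neg, Real.fourier_eq]
    rw [← integral_sub (by simpa using (Real.fourierIntegral_convergent_iff (-x)).2 hs'.integrable)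
      (by simpa using (Real.fourierIntegral_convergent_iff (-x)).2 hf.integrable), ← integral_div]
    congr with w
    simp only [Circle.smul_def, smul_eq_mul]
    ring
  have h2 := (measurePreserving_add_right volume h).quasiMeasurePreserving.ae hf.toBL_ae_eq
  calc _ = ∫ x, ‖𝓕⁻ (fun w => ((Complex.exp
      ((2 * Real.pi * (w * h) : ℝ) * Complex.I) - 1) / h) * f w) x‖ ^ 2 := by
        apply integral_congr_ae
        filter_upwards [h2, hf.toBL_ae_eq] with x h3 h4
        rw [h3, h4, h1]
    _ = _ := by
        rw [integral_norm_sq_fourierInv hs.integrable hs.memLp]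
        congr with w
        rw [Complex.mul_conj, Complex.ofReal_re, Complex.normSq_eq_norm_sq, norm_mul, mul_pow,
          norm_div, div_pow]
        congr 2
        · rw [norm_exp_mul_I_sub_one_sq, ← mul_assoc]
        · simp

theorem realInner_deriv (hf : IsBand h f) :
    realInner (Complex.I • BL.deriv hf.toBL) (hf.toBL : L2C)
      = ∫ w, -(2 * Real.pi * w) * (f w * (starRingEnd ℂ) (f w)).re := by
  have h1 : ∀ a b : L2C, realInner a b = (inner ℂ b a).re := by
    intro a b
    rw [inner_L2_eq, realInner]
    exact (Complex.reCLM.integral_comp_comm ((Lp.memLp a).integrable_mul (Lp.memLp b).star))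
  rw [h1, inner_smul_right, hf.deriv_toBL, toBL, inner_fourierInv, inner_L2_eq]
  have h2 : ∫ w, (hf.deriv.memLp.toLp _ : L2C) w * (starRingEnd ℂ) ((hf.memLp.toLp f : L2C) w)
      = ∫ w, Complex.I * ((2 * Real.pi * w * (f w * (starRingEnd ℂ) (f w)).re : ℝ) : ℂ) := by
    apply integral_congr_ae
    filter_upwards [hf.deriv.memLp.coeFn_toLp, hf.memLp.coeFn_toLp] with w h3 h4
    rw [h3, h4, mul_assoc, Complex.mul_conj]
    push_cast
    simp
    ring
  rw [h2, integral_const_mul, integral_complex_ofReal, ← mul_assoc, Complex.I_mul_I]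
  simp [integral_neg]

theorem lagrangian_toBL (hf : IsBand h f) (ξ : ℝ × ℝ) :
    lagrangian h ξ hf.toBL = (1 / 2) * (∫ w, symbol h ξ w * (f w * (starRingEnd ℂ) (f w)).re)
      - (1 / 4) * ∫ x, ‖𝓕⁻ f x‖ ^ 4 := by
  have h1 : ∫ x, ‖(hf.toBL : L2C) x‖ ^ 4 = ∫ x, ‖𝓕⁻ f x‖ ^ 4 := by
    apply integral_congr_ae
    filter_upwards [hf.toBL_ae_eq] with x hx
    rw [hx]
  have h2 : ∫ w, symbol h ξ w * (f w * (starRingEnd ℂ) (f w)).re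
      = (∫ w, (2 - 2 * Real.cos (2 * Real.pi * w * h)) / h ^ 2 * (f w * (starRingEnd ℂ) (f w)).re)
        + ξ.1 * (∫ w, ‖f w‖ ^ 2) + ξ.2 * ∫ w, -(2 * Real.pi * w) * (f w * (starRingEnd ℂ) (f w)).re := by
    have i1 := hf.integrable_mul_re hf
      (m := fun w => (2 - 2 * Real.cos (2 * Real.pi * w * h)) / h ^ 2) (by fun_prop)
    have i2 : Integrable fun w => ‖f w‖ ^ 2 :=
      (memLp_two_iff_integrable_sq_norm hf.measurable.aestronglyMeasurable).1 hf.memLp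
    have i3 := hf.integrable_mul_re hf (m := fun w => -(2 * Real.pi * w)) (by fun_prop)
    rw [← integral_const_mul, ← integral_const_mul, ← integral_add i1 (i2.const_mul _)]
    refine Eq.trans ?_ (integral_add (i1.add (i2.const_mul ξ.1)) (i3.const_mul ξ.2))
    congr with w
    simp only [symbol]
    rw [Complex.mul_conj, Complex.ofReal_re, Complex.normSq_eq_norm_sq]
    ring
  rw [lagrangian, hamiltonian, hf.integral_sq_shift, hf.realInner_deriv, hf.norm_sq_toBL, h1, h2]
  ring

end IsBand

/-! ### First variation and the Euler–Lagrange equation -/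

/-- The function is integrable, and bounded by `tripleConv_le`, hence square integrable. -/
theorem memLp_cubicConv {f : ℝ → ℂ} (hm : Measurable f) (hf : Integrable f) (hf2 : MemLp f 2) :
    MemLp (cubicConv f) 2 := by
  have h1 : ∀ w, ‖cubicConv f w‖ₑ ≤ 2 * (∫⁻ a, ‖f a‖ₑ) * ∫⁻ a, ‖f a‖ₑ ^ 2 := fun w =>
    (enorm_cubicConv_le f w).trans (tripleConv_le hm.enorm w)
  have h2 : 2 * (∫⁻ a, ‖f a‖ₑ) * (∫⁻ a, ‖f a‖ₑ ^ 2) < ∞ := by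
    refine ENNReal.mul_lt_top (ENNReal.mul_lt_top ENNReal.ofNat_lt_top hf.2) ?_
    have h3 := lintegral_rpow_enorm_lt_top_of_eLpNorm_lt_top two_ne_zero ENNReal.ofNat_ne_top hf2.2
    simpa using h3
  have hi := integrable_cubicConv hf
  rw [memLp_two_iff_integrable_sq_norm hi.1]
  have h4 := hi.norm.bdd_mul (c := (2 * (∫⁻ a, ‖f a‖ₑ) * ∫⁻ a, ‖f a‖ₑ ^ 2).toReal)
    (f := fun w => ‖cubicConv f w‖) hi.1.norm (ae_of_all _ fun w => ?_)
  · simpa [sq] using h4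
  · rw [norm_norm, ← toReal_enorm]
    exact ENNReal.toReal_mono h2.ne (h1 w)

/-- Along a line the Lagrange function is a quartic polynomial in `t`, so the first variation is
read off as the coefficient of `t`. -/
theorem eq_of_hasDerivAt_quartic {φ : ℝ → ℝ} {a b c d e l : ℝ}
    (hφ : ∀ t, φ t = a + b * t + c * t ^ 2 + d * t ^ 3 + e * t ^ 4) (h : HasDerivAt φ l 0) :
    b = l := by
  have h1 : HasDerivAt φ b 0 := by
    rw [funext hφ]
    have h2 := (((((hasDerivAt_id' (0 : ℝ)).const_mul b).const_add a).add
      ((hasDerivAt_pow 2 (0 : ℝ)).const_mul c)).add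
      ((hasDerivAt_pow 3 (0 : ℝ)).const_mul d)).add ((hasDerivAt_pow 4 (0 : ℝ)).const_mul e)
    exact h2.congr_deriv (by simp)
  exact h1.unique h

theorem norm_add_smul_sq (z w : ℂ) (t : ℝ) :
    ‖z + t • w‖ ^ 2 = ‖z‖ ^ 2 + 2 * (z * (starRingEnd ℂ) w).re * t + ‖w‖ ^ 2 * t ^ 2 := by
  simp only [← Complex.normSq_eq_norm_sq, Complex.normSq_apply]
  simp
  ring

namespace IsBand

variable {h : ℝ} {f g : ℝ → ℂ}

theorem continuous_fourierInv (hf : IsBand h f) : Continuous (𝓕⁻ f) :=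
  _root_.continuous_fourierInv hf.integrable

theorem fourierInv_add_smul (hf : IsBand h f) (hg : IsBand h g) (t x : ℝ) :
    𝓕⁻ (f + t • g) x = 𝓕⁻ f x + t • 𝓕⁻ g x := by
  simp only [Real.fourierInv_eq_fourier_neg, Real.fourier_eq]
  have h1 := (Real.fourierIntegral_convergent_iff (-x)).2 hf.integrable
  have h2 := ((Real.fourierIntegral_convergent_iff (-x)).2 hg.integrable).smul t
  rw [← integral_smul]
  refine Eq.trans ?_ (integral_add h1 h2)
  congr with w
  simp only [Pi.add_apply, Pi.smul_apply, smul_add, smul_comm t]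

/-- Products of four band-limited factors are integrable. -/
theorem integrable_of_abs_le (hf : IsBand h f) (hg : IsBand h g) {p : ℝ → ℝ} (hp : Continuous p)
    {C : ℝ} (hpC : ∀ x, |p x| ≤ C * (‖𝓕⁻ f x‖ + ‖𝓕⁻ g x‖) ^ 4) : Integrable p := by
  set B : ℝ := (∫ w, ‖f w‖) + ∫ w, ‖g w‖ with hB
  have hB' : ∀ x, ‖𝓕⁻ f x‖ + ‖𝓕⁻ g x‖ ≤ B := fun x =>
    add_le_add (norm_fourierInv_le f x) (norm_fourierInv_le g x)
  have h2 : Integrable fun x => (‖𝓕⁻ f x‖ + ‖𝓕⁻ g x‖) ^ 2 := by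
    have h3 : MemLp (fun x => ‖𝓕⁻ f x‖ + ‖𝓕⁻ g x‖) 2 :=
      (memLp_fourierInv hf.integrable hf.memLp).norm.add
        (memLp_fourierInv hg.integrable hg.memLp).norm
    simpa using (memLp_two_iff_integrable_sq_norm h3.1).1 h3
  refine (h2.const_mul (|C| * B ^ 2)).mono' hp.aestronglyMeasurable (ae_of_all _ fun x => ?_)
  have h0 : 0 ≤ ‖𝓕⁻ f x‖ + ‖𝓕⁻ g x‖ := by positivity
  calc ‖p x‖ ≤ |C| * ((‖𝓕⁻ f x‖ + ‖𝓕⁻ g x‖) ^ 2 * (‖𝓕⁻ f x‖ + ‖𝓕⁻ g x‖) ^ 2) := by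
        rw [Real.norm_eq_abs, ← pow_add]
        refine (hpC x).trans ?_
        gcongr
        exact le_abs_self C
    _ ≤ |C| * (B ^ 2 * (‖𝓕⁻ f x‖ + ‖𝓕⁻ g x‖) ^ 2) := by
        gcongr
        exact hB' x
    _ = _ := by ring

/-- Square `‖u + tv‖² = ‖u‖² + 2t Re(u conj v) + t²‖v‖²` and integrate; only the coefficient of `t`
matters later. -/
theorem exists_integral_norm_pow_four (hf : IsBand h f) (hg : IsBand h g) :
    ∃ a c d e : ℝ, ∀ t : ℝ, ∫ x, ‖𝓕⁻ (f + t • g) x‖ ^ 4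
      = a + (4 * ∫ x, ‖𝓕⁻ f x‖ ^ 2 * (𝓕⁻ f x * (starRingEnd ℂ) (𝓕⁻ g x)).re) * t + c * t ^ 2
        + d * t ^ 3 + e * t ^ 4 := by
  have cf := hf.continuous_fourierInv
  have cg := hg.continuous_fourierInv
  set u := 𝓕⁻ f with hu
  set v := 𝓕⁻ g with hv
  set r : ℝ → ℝ := fun x => (u x * (starRingEnd ℂ) (v x)).re with hr
  have cr : Continuous r := by
    have : Continuous fun x => (starRingEnd ℂ) (v x) := Complex.continuous_conj.comp cg
    exact Complex.continuous_re.comp (cf.mul this)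
  have hrle : ∀ x, |r x| ≤ ‖u x‖ * ‖v x‖ := fun x => by
    refine (Complex.abs_re_le_norm _).trans_eq ?_
    rw [norm_mul, RCLike.norm_conj]
  have bound : ∀ {p : ℝ → ℝ}, Continuous p → (∃ C : ℝ, ∀ x, |p x| ≤ C * (‖u x‖ + ‖v x‖) ^ 4) →
      Integrable p := fun hp ⟨C, hC⟩ => hf.integrable_of_abs_le hg hp hC
  have le1 : ∀ x, ‖u x‖ ≤ ‖u x‖ + ‖v x‖ := fun x => by linarith [norm_nonneg (v x)]
  have le2 : ∀ x, ‖v x‖ ≤ ‖u x‖ + ‖v x‖ := fun x => by linarith [norm_nonneg (u x)]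
  have le3 : ∀ x, |r x| ≤ (‖u x‖ + ‖v x‖) ^ 2 := fun x => by
    rw [sq]
    exact (hrle x).trans (mul_le_mul (le1 x) (le2 x) (norm_nonneg _) (by positivity))
  have leu : ∀ x, ‖u x‖ ^ 2 ≤ (‖u x‖ + ‖v x‖) ^ 2 := fun x => by gcongr; exact le1 x
  have lev : ∀ x, ‖v x‖ ^ 2 ≤ (‖u x‖ + ‖v x‖) ^ 2 := fun x => by gcongr; exact le2 x
  have prod : ∀ {p q : ℝ → ℝ}, Continuous p → Continuous q →
      (∀ x, |p x| ≤ (‖u x‖ + ‖v x‖) ^ 2) → (∀ x, |q x| ≤ (‖u x‖ + ‖v x‖) ^ 2) →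
      Integrable fun x => p x * q x := fun {p q} hp hq h1 h2 => by
    refine bound (hp.mul hq) ⟨1, fun x => ?_⟩
    rw [abs_mul, one_mul, show (‖u x‖ + ‖v x‖) ^ 4
      = (‖u x‖ + ‖v x‖) ^ 2 * (‖u x‖ + ‖v x‖) ^ 2 by ring]
    exact mul_le_mul (h1 x) (h2 x) (abs_nonneg _) (by positivity)
  have leu' : ∀ x, |‖u x‖ ^ 2| ≤ (‖u x‖ + ‖v x‖) ^ 2 := fun x => by
    rw [abs_of_nonneg (by positivity)]; exact leu x
  have lev' : ∀ x, |‖v x‖ ^ 2| ≤ (‖u x‖ + ‖v x‖) ^ 2 := fun x => by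
    rw [abs_of_nonneg (by positivity)]; exact lev x
  have cu2 : Continuous fun x => ‖u x‖ ^ 2 := by fun_prop
  have cv2 : Continuous fun x => ‖v x‖ ^ 2 := by fun_prop
  have i0 := prod cu2 cu2 leu' leu'
  have i1 := prod cu2 cr leu' le3
  have i2 := prod cr cr le3 le3
  have i2' := prod cu2 cv2 leu' lev'
  have i3 := prod cr cv2 le3 lev'
  have i4 := prod cv2 cv2 lev' lev'
  refine ⟨∫ x, ‖u x‖ ^ 2 * ‖u x‖ ^ 2, (4 * ∫ x, r x * r x) + 2 * ∫ x, ‖u x‖ ^ 2 * ‖v x‖ ^ 2,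
    4 * ∫ x, r x * ‖v x‖ ^ 2, ∫ x, ‖v x‖ ^ 2 * ‖v x‖ ^ 2, fun t => ?_⟩
  have e : ∀ x, ‖𝓕⁻ (f + t • g) x‖ ^ 4 = ‖u x‖ ^ 2 * ‖u x‖ ^ 2 + 4 * t * (‖u x‖ ^ 2 * r x)
      + 4 * t ^ 2 * (r x * r x) + 2 * t ^ 2 * (‖u x‖ ^ 2 * ‖v x‖ ^ 2)
      + 4 * t ^ 3 * (r x * ‖v x‖ ^ 2) + t ^ 4 * (‖v x‖ ^ 2 * ‖v x‖ ^ 2) := by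
    intro x
    rw [fourierInv_add_smul hf hg, show (4 : ℕ) = 2 * 2 by norm_num, pow_mul, norm_add_smul_sq]
    simp only [hr, hu, hv]
    ring
  simp_rw [e]
  rw [integral_add (by fun_prop) (by fun_prop), integral_add (by fun_prop) (by fun_prop),
    integral_add (by fun_prop) (by fun_prop), integral_add (by fun_prop) (by fun_prop),
    integral_add (by fun_prop) (by fun_prop)]
  simp only [integral_const_mul]
  ring

theorem integral_mul_normSq_add_smul (hf : IsBand h f) (hg : IsBand h g) {m : ℝ → ℝ}
    (hm : Continuous m) (t : ℝ) :
    ∫ w, m w * ((f + t • g) w * (starRingEnd ℂ) ((f + t • g) w)).re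
      = (∫ w, m w * (f w * (starRingEnd ℂ) (f w)).re)
        + (2 * ∫ w, m w * (f w * (starRingEnd ℂ) (g w)).re) * t
        + (∫ w, m w * (g w * (starRingEnd ℂ) (g w)).re) * t ^ 2 := by
  have i0 := hf.integrable_mul_re hf hm
  have i1 := hf.integrable_mul_re hg hm
  have i2 := hg.integrable_mul_re hg hm
  have e : ∀ w, m w * ((f + t • g) w * (starRingEnd ℂ) ((f + t • g) w)).re
      = m w * (f w * (starRingEnd ℂ) (f w)).re + 2 * t * (m w * (f w * (starRingEnd ℂ) (g w)).re)
        + t ^ 2 * (m w * (g w * (starRingEnd ℂ) (g w)).re) := by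
    intro w
    simp
    ring
  simp_rw [e]
  rw [integral_add (by fun_prop) (by fun_prop), integral_add (by fun_prop) (by fun_prop)]
  simp only [integral_const_mul]
  ring

theorem integral_symbol_eq_of_isCriticalPoint (hf : IsBand h f) (hg : IsBand h g) {ξ : ℝ × ℝ}
    (hc : IsCriticalPoint h ξ hf.toBL) :
    ∫ w, symbol h ξ w * (f w * (starRingEnd ℂ) (g w)).re
      = ∫ x, ‖𝓕⁻ f x‖ ^ 2 * (𝓕⁻ f x * (starRingEnd ℂ) (𝓕⁻ g x)).re := by
  obtain ⟨a, c, d, e, h4⟩ := hf.exists_integral_norm_pow_four hg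
  have h2 := hf.integral_mul_normSq_add_smul hg (continuous_symbol h ξ)
  have hd : HasDerivAt (fun t : ℝ => lagrangian h ξ (hf.toBL + t • hg.toBL)) 0 0 :=
    HasFDerivAt.hasLineDerivAt hc hg.toBL
  set I := ∫ w, symbol h ξ w * (f w * (starRingEnd ℂ) (g w)).re
  set J := ∫ x, ‖𝓕⁻ f x‖ ^ 2 * (𝓕⁻ f x * (starRingEnd ℂ) (𝓕⁻ g x)).re
  have key : I - J = 0 := by
    refine eq_of_hasDerivAt_quartic
      (a := (1 / 2) * (∫ w, symbol h ξ w * (f w * (starRingEnd ℂ) (f w)).re) - (1 / 4) * a)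
      (c := (1 / 2) * (∫ w, symbol h ξ w * (g w * (starRingEnd ℂ) (g w)).re) - (1 / 4) * c)
      (d := -((1 / 4) * d)) (e := -((1 / 4) * e)) (fun t => ?_) hd
    simp only [hf.toBL_add_smul hg, lagrangian_toBL, h4, h2]
    ring
  linarith

/-- The Euler-Lagrange equation of a critical point, on the Fourier side. -/
theorem symbol_mul_eq_cubicConv (hf : IsBand h f) {ξ : ℝ × ℝ}
    (hc : IsCriticalPoint h ξ hf.toBL) :
    ∀ᵐ w, w ∈ freqBand h → symbol h ξ w * f w = cubicConv f w := by
  have hW1 := integrable_cubicConv hf.integrable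
  have hW2 := memLp_cubicConv hf.measurable hf.integrable hf.memLp
  -- `IsBand` demands genuine measurability, so the convolution is replaced by a measurable
  -- representative.
  obtain ⟨W, hWm, hW⟩ := hW2.1
  have hPf : IsBand h (fun w => (symbol h ξ w : ℂ) * f w) :=
    hf.continuous_mul (Complex.continuous_ofReal.comp (continuous_symbol h ξ))
  have hk2 : MemLp ((fun w => (symbol h ξ w : ℂ) * f w) - W) 2 :=
    hPf.memLp.sub ((memLp_congr_ae hW).1 hW2)
  have hg : IsBand h _ := IsBand.indicator (hPf.measurable.sub hWm.measurable) hk2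
  -- The test direction is the residual of the equation itself, cut off to the band to be
  -- admissible; the weak equation then says that its `L²` norm vanishes.
  set g := (freqBand h).indicator ((fun w => (symbol h ξ w : ℂ) * f w) - W) with hgdef
  have h1 := hf.integral_symbol_eq_of_isCriticalPoint hg hc
  have iW : Integrable fun w => cubicConv f w * (starRingEnd ℂ) (g w) :=
    hW2.integrable_mul hg.memLp.star
  have h2 : ∫ x, ‖𝓕⁻ f x‖ ^ 2 * (𝓕⁻ f x * (starRingEnd ℂ) (𝓕⁻ g x)).re
      = ∫ w, (cubicConv f w * (starRingEnd ℂ) (g w)).re := by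
    have h3 := integral_fourierInv_mul_conj hW1 hW2 hg.integrable hg.memLp
    have iL : Integrable fun x => 𝓕⁻ (cubicConv f) x * (starRingEnd ℂ) (𝓕⁻ g x) :=
      (memLp_fourierInv hW1 hW2).integrable_mul (memLp_fourierInv hg.integrable hg.memLp).star
    have h4 := congrArg Complex.re h3
    rw [← Complex.reCLM_apply, ← Complex.reCLM_apply, ← Complex.reCLM.integral_comp_comm iL,
      ← Complex.reCLM.integral_comp_comm iW] at h4
    simp only [Complex.reCLM_apply] at h4
    rw [← h4]
    congr with x
    rw [fourierInv_cubicConv hf.integrable, mul_assoc, Complex.re_ofReal_mul]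
  have h5 : ∫ w, ‖g w‖ ^ 2 = 0 := by
    have h6 : ∫ w, ‖g w‖ ^ 2 = ∫ w, (symbol h ξ w * (f w * (starRingEnd ℂ) (g w)).re
        - (cubicConv f w * (starRingEnd ℂ) (g w)).re) := by
      apply integral_congr_ae
      filter_upwards [hW] with w hw
      rw [hw, ← Complex.re_ofReal_mul, ← Complex.sub_re, ← mul_assoc, ← sub_mul]
      by_cases hwb : w ∈ freqBand h
      · have : symbol h ξ w * f w - W w = g w := by
          rw [hgdef, Set.indicator_of_mem hwb]
          rfl
        rw [this, Complex.mul_conj, Complex.ofReal_re, Complex.normSq_eq_norm_sq]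
      · simp [hg.eq_zero w (notMem_freqBand.1 hwb)]
    have iW' : Integrable fun w => (cubicConv f w * (starRingEnd ℂ) (g w)).re := iW.re
    rw [h6, integral_sub (hf.integrable_mul_re hg (continuous_symbol h ξ)) iW', h1, h2]
    exact sub_self _
  rw [integral_eq_zero_iff_of_nonneg (fun _ => by positivity)
    ((memLp_two_iff_integrable_sq_norm hg.measurable.aestronglyMeasurable).1 hg.memLp)] at h5
  filter_upwards [h5, hW] with w h6 h7 hwb
  have h8 : g w = 0 := by simpa using h6
  rw [hgdef, Set.indicator_of_mem hwb] at h8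
  rw [h7]
  exact sub_eq_zero.1 h8

end IsBand

/-! ### Uniform ellipticity of the symbol -/

/-- `cos y ≤ 1 - 2y²/π²` on `[-π, π]`, together with `π² < 10`. -/
theorem four_div_ten_mul_sq_le {y : ℝ} (hy : |y| ≤ Real.pi) :
    (4 / 10) * y ^ 2 ≤ 2 - 2 * Real.cos y := by
  have h1 := Real.cos_le_one_sub_mul_cos_sq hy
  have h2 : 2 / 10 ≤ 2 / Real.pi ^ 2 := by
    gcongr
    nlinarith [Real.pi_lt_d2, Real.pi_pos]
  nlinarith [mul_le_mul_of_nonneg_right h2 (sq_nonneg y)]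

/-- Ellipticity of the symbol, uniformly for small step sizes. -/
theorem exists_le_symbol (Ω : Set (ℝ × ℝ)) (hΩc : IsCompact (closure Ω))
    (hΩs : closure Ω ⊆ {ξ : ℝ × ℝ | (ξ.2 / 2) ^ 2 < ξ.1}) :
    ∃ h₀ α : ℝ, 0 < h₀ ∧ 0 < α ∧ ∀ h : ℝ, 0 < h → h < h₀ → ∀ ξ ∈ Ω, ∀ w ∈ freqBand h,
      α * (1 + w ^ 2) ≤ symbol h ξ w := by
  obtain ⟨δ, hδ, hδΩ⟩ := hΩc.exists_forall_le' (f := fun ξ : ℝ × ℝ => ξ.1 - (ξ.2 / 2) ^ 2)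
    (by fun_prop) (a := 0) (fun ξ hξ => sub_pos.2 (hΩs hξ))
  obtain ⟨B, hB, hBΩ⟩ := hΩc.isBounded.exists_pos_norm_le
  -- For `|ω| ≥ R` one has `B|ω| ≤ ω²/5`, half of the `(4/10) ω²` that the discrete Laplacian
  -- provides; the `+ 1` ensures `ω² ≥ 1`.
  set R : ℝ := 5 * B + 1 with hRdef
  have hR1 : 1 ≤ R := by linarith
  refine ⟨min 1 δ / R ^ 2, min (δ / 2 / (1 + R ^ 2)) (1 / 10), by positivity, by positivity, ?_⟩
  intro h hh hh0 ξ hξ w hw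
  have hδξ := hδΩ ξ (subset_closure hξ)
  have hξ2 : |ξ.2| ≤ B := (norm_snd_le ξ).trans (hBΩ ξ (subset_closure hξ))
  rw [lt_div_iff₀ (by positivity)] at hh0
  have hh1 : h * R ^ 2 ≤ 1 := hh0.le.trans (min_le_left _ _)
  have hhδ : h * R ^ 2 ≤ δ := hh0.le.trans (min_le_right _ _)
  have hpi := Real.pi_gt_three
  obtain ⟨ω, hω⟩ : ∃ ω : ℝ, ω = 2 * Real.pi * w := ⟨_, rfl⟩
  have hwω : w ^ 2 ≤ ω ^ 2 := by
    rw [hω, mul_pow]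
    exact le_mul_of_one_le_left (sq_nonneg w) (by nlinarith)
  have hωh : |ω * h| ≤ Real.pi := by
    rw [mem_freqBand, le_div_iff₀ hh] at hw
    rwa [hω, abs_mul, abs_mul, abs_of_pos hh, abs_of_pos (by positivity : 0 < 2 * Real.pi)]
  have hsym : symbol h ξ w = (2 - 2 * Real.cos (ω * h)) / h ^ 2 + ξ.1 - ξ.2 * ω := by
    rw [symbol, hω]
    ring
  rw [hsym]
  rcases le_total |ω| R with hωR | hωR
  -- Low frequencies: `h R² ≤ 1` and `h R² ≤ δ` give `(ωh)⁴ ≤ δh²`, so the Taylor error of the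
  -- cosine costs at most half of the gap `δ`.
  · have h1 : ω ^ 2 - δ / 2 ≤ (2 - 2 * Real.cos (ω * h)) / h ^ 2 := by
      rw [le_div_iff₀ (by positivity)]
      have hs : |ω * h| ≤ 1 := by
        rw [abs_mul, abs_of_pos hh]
        calc |ω| * h ≤ R ^ 2 * h := by gcongr; nlinarith
          _ ≤ 1 := by linarith
      have h2 := (abs_le.1 (Real.cos_bound hs)).2
      have h3 : |ω * h| ^ 4 ≤ δ * h ^ 2 := by
        have h4 : |ω| ^ 4 ≤ R ^ 4 := by gcongr
        have h5 : h * R ^ 2 * (h * R ^ 2) ≤ 1 * δ := by gcongr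
        calc |ω * h| ^ 4 = |ω| ^ 4 * h ^ 4 := by rw [abs_mul, abs_of_pos hh, mul_pow]
          _ ≤ R ^ 4 * h ^ 4 := by gcongr
          _ = (h * R ^ 2 * (h * R ^ 2)) * h ^ 2 := by ring
          _ ≤ (1 * δ) * h ^ 2 := by gcongr
          _ = δ * h ^ 2 := by ring
      have h6 : 0 < δ * h ^ 2 := by positivity
      nlinarith
    have h7 : ω ^ 2 ≤ R ^ 2 := by
      rw [← sq_abs]
      gcongr
    calc _ ≤ δ / 2 / (1 + R ^ 2) * (1 + R ^ 2) := by
          refine mul_le_mul (min_le_left _ _) ?_ (by positivity) (by positivity)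
          linarith
      _ = δ / 2 := by field_simp
      _ ≤ _ := by nlinarith [sq_nonneg (ω - ξ.2 / 2)]
  -- High frequencies: Taylor expansion is unavailable up to the band edge, but `|ωh| ≤ π` suffices
  -- for the cruder quadratic bound.
  · have h1 : 4 / 10 * ω ^ 2 ≤ (2 - 2 * Real.cos (ω * h)) / h ^ 2 := by
      rw [le_div_iff₀ (by positivity)]
      have := four_div_ten_mul_sq_le hωh
      nlinarith
    have h2 : ξ.2 * ω ≤ B * |ω| := by
      refine (le_abs_self _).trans ?_
      rw [abs_mul]
      gcongr
    have h3 : 0 ≤ ξ.1 := by nlinarith [sq_nonneg (ξ.2 / 2)]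
    have h4 : R * |ω| ≤ ω ^ 2 := by
      rw [← sq_abs, sq]
      gcongr
    have h5 : 1 ≤ ω ^ 2 := by
      rw [← sq_abs]
      nlinarith
    calc _ ≤ (1 / 10) * (1 + ω ^ 2) := by
          gcongr
          exact min_le_right _ _
      _ ≤ _ := by nlinarith [abs_nonneg ω]

/-! ### Bounds on the transform from the `H¹` norm -/

namespace IsBand

variable {h M : ℝ} {f : ℝ → ℂ}

theorem integrable_norm_sq (hf : IsBand h f) : Integrable fun w => ‖f w‖ ^ 2 :=
  (memLp_two_iff_integrable_sq_norm hf.measurable.aestronglyMeasurable).1 hf.memLp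

theorem integrable_weight_mul_norm_sq (hf : IsBand h f) :
    Integrable fun w => (1 + (2 * Real.pi * w) ^ 2) * ‖f w‖ ^ 2 := by
  refine (hf.integrable_mul_re hf (m := fun w => 1 + (2 * Real.pi * w) ^ 2) (by fun_prop)).congr
    (ae_of_all _ fun w => ?_)
  dsimp only
  rw [Complex.mul_conj, Complex.ofReal_re, Complex.normSq_eq_norm_sq]

theorem integral_weight_le (hf : IsBand h f) (hM : BL.h1Norm hf.toBL ≤ M) :
    ∫ w, (1 + (2 * Real.pi * w) ^ 2) * ‖f w‖ ^ 2 ≤ M ^ 2 := by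
  rw [← hf.h1Norm_toBL_sq]
  have : 0 ≤ BL.h1Norm hf.toBL := Real.sqrt_nonneg _
  gcongr

theorem lintegral_enorm_sq_le (hf : IsBand h f) (hM : BL.h1Norm hf.toBL ≤ M) :
    ∫⁻ w, ‖f w‖ₑ ^ 2 ≤ ENNReal.ofReal (M ^ 2) := by
  have h1 : ∫ w, ‖f w‖ ^ 2 ≤ M ^ 2 := by
    refine le_trans ?_ (hf.integral_weight_le hM)
    refine integral_mono hf.integrable_norm_sq hf.integrable_weight_mul_norm_sq fun w => ?_
    exact le_mul_of_one_le_left (by positivity) (by nlinarith [sq_nonneg (2 * Real.pi * w)])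
  refine le_trans (le_of_eq ?_) (ENNReal.ofReal_le_ofReal h1)
  rw [ofReal_integral_eq_lintegral_ofReal hf.integrable_norm_sq (ae_of_all _ fun w => by positivity)]
  congr with w
  rw [ENNReal.ofReal_pow (norm_nonneg _), ofReal_norm]

theorem lintegral_enorm_le (hf : IsBand h f) (hM : BL.h1Norm hf.toBL ≤ M) :
    ∫⁻ w, ‖f w‖ₑ ≤ ENNReal.ofReal (Real.pi + M ^ 2) := by
  rw [← ofReal_integral_norm_eq_lintegral_enorm hf.integrable]
  apply ENNReal.ofReal_le_ofReal
  calc ∫ w, ‖f w‖ ≤ ∫ w, ((1 + w ^ 2)⁻¹ + (1 + (2 * Real.pi * w) ^ 2) * ‖f w‖ ^ 2) := by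
        refine integral_mono hf.integrable.norm
          (integrable_inv_one_add_sq.add hf.integrable_weight_mul_norm_sq) fun w => ?_
        dsimp only
        have h1 : 1 + w ^ 2 ≤ 1 + (2 * Real.pi * w) ^ 2 := by
          rw [mul_pow]
          have : 1 ≤ (2 * Real.pi) ^ 2 := by nlinarith [Real.pi_gt_three]
          gcongr
          exact le_mul_of_one_le_left (sq_nonneg w) this
        have h2 : 0 < 1 + w ^ 2 := by positivity
        have h3 : (1 + w ^ 2) * ‖f w‖ ^ 2 ≤ (1 + (2 * Real.pi * w) ^ 2) * ‖f w‖ ^ 2 := by gcongr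
        refine le_trans ?_ (add_le_add le_rfl h3)
        -- With `y = (1 + w²)‖f w‖` the claim is `1 - y + y² ≥ 0`, a sum of squares.
        rw [← sub_nonneg]
        have h4 : (1 + w ^ 2)⁻¹ + (1 + w ^ 2) * ‖f w‖ ^ 2 - ‖f w‖
            = (1 + w ^ 2)⁻¹ * ((1 - (1 + w ^ 2) * ‖f w‖ / 2) ^ 2
              + 3 / 4 * ((1 + w ^ 2) * ‖f w‖) ^ 2) := by
          field_simp
          ring
        rw [h4]
        positivity
    _ ≤ Real.pi + M ^ 2 := by
        rw [integral_add integrable_inv_one_add_sq hf.integrable_weight_mul_norm_sq,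
          integral_univ_inv_one_add_sq]
        gcongr
        exact hf.integral_weight_le hM

end IsBand
end

/-! ### Choice of constants and conclusion -/

theorem theorem3p10 (Ω : Set (ℝ × ℝ)) (hΩ : IsOpen Ω) (hΩc : IsCompact (closure Ω))
    (hΩs : closure Ω ⊆ {ξ : ℝ × ℝ | (ξ.2 / 2) ^ 2 < ξ.1}) :
    ∃ h₀ : ℝ, 0 < h₀ ∧ ∀ M : ℝ, 0 < M → ∃ C ε : ℝ, 0 < C ∧ 0 < ε ∧
      ∀ h : ℝ, 0 < h → h < h₀ → ∀ ξ ∈ Ω, ∀ u : BL h, BL.h1Norm u ≤ M →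
        IsCriticalPoint h ξ u →
          ∀ᵐ ω : ℝ, ‖hat (u : L2C) ω‖ < C * Real.exp (-ε * |ω|) := by
  obtain ⟨h₀, α, hh₀, hα, hsym⟩ := exists_le_symbol Ω hΩc hΩs
  refine ⟨h₀, hh₀, fun M hM => ?_⟩
  have hpi := Real.pi_pos
  set A : ℝ := Real.pi + M ^ 2 with hA
  set κ : ℝ := α⁻¹ with hκ
  -- The largest rate that the bootstrap condition allows.
  set ε : ℝ := (κ * (2 * (A + 1)) ^ 3)⁻¹ with hε
  set C : ℝ := 4 * κ ^ 2 * A * M ^ 2 * (A + 1) ^ 2 with hC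
  have hA0 : 0 < A := by positivity
  have hκ0 : 0 < κ := by positivity
  have hε0 : 0 < ε := by positivity
  have hC0 : 0 < C := by positivity
  -- `C + 1` makes the inequality strict; the `2π` converts the frequency `w` to `ω = -2πw`.
  refine ⟨C + 1, ε / 2 / (2 * Real.pi), by positivity, by positivity, ?_⟩
  intro h hh hhh ξ hξ u hu hc
  obtain ⟨f, hf, rfl⟩ := BL.exists_isBand u
  have hT : ∀ᵐ w : ℝ, ENNReal.ofReal (1 + w ^ 2) * ‖f w‖ₑ
      ≤ ENNReal.ofReal κ * tripleConv (fun w => ‖f w‖ₑ) w := by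
    filter_upwards [hf.symbol_mul_eq_cubicConv hc] with w hw
    by_cases hwb : w ∈ freqBand h
    · have h1 := hsym h hh hhh ξ hξ w hwb
      have h2 : ENNReal.ofReal (symbol h ξ w) * ‖f w‖ₑ ≤ tripleConv (fun w => ‖f w‖ₑ) w := by
        refine le_trans (le_of_eq ?_) (enorm_cubicConv_le f w)
        rw [← hw hwb, enorm_mul]
        congr 1
        have : 0 ≤ symbol h ξ w := le_trans (by positivity) h1
        rw [← ofReal_norm, Complex.norm_real, Real.norm_of_nonneg this]
      have h3 : 1 + w ^ 2 ≤ κ * symbol h ξ w := by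
        rw [hκ, ← div_eq_inv_mul, le_div_iff₀ hα]
        linarith
      calc _ ≤ ENNReal.ofReal (κ * symbol h ξ w) * ‖f w‖ₑ := by gcongr
        _ = ENNReal.ofReal κ * (ENNReal.ofReal (symbol h ξ w) * ‖f w‖ₑ) := by
            rw [ENNReal.ofReal_mul hκ0.le, mul_assoc]
        _ ≤ _ := by gcongr
    · simp [hf.eq_zero w (notMem_freqBand.1 hwb)]
  -- The support radius depends on `h` but is absent from the resulting bound, hence the uniformity.
  have hdecay := le_exp_of_le_tripleConv (F := fun w => ‖f w‖ₑ) hf.measurable.enorm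
    (R := |Real.pi / h|) (fun w hw => by simp [hf.eq_zero_of_lt hw]) hκ0 hT hA0.le
    (hf.lintegral_enorm_le hu) (sq_nonneg M) (hf.lintegral_enorm_sq_le hu) hε0.le
    (by rw [mul_assoc, hε, inv_mul_cancel₀ (by positivity)])
  filter_upwards [hf.hat_toBL, quasiMeasurePreserving_hatScale.ae hdecay] with ω h1 h2
  rw [h1]
  rw [← ofReal_norm, ENNReal.ofReal_le_ofReal_iff (by positivity)] at h2
  refine h2.trans_lt ?_
  have h3 : -(ε / 2) * |-ω / (2 * Real.pi)| = -(ε / 2 / (2 * Real.pi)) * |ω| := by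
    rw [abs_div, abs_neg, abs_of_pos (by positivity : 0 < 2 * Real.pi)]
    ring
  rw [h3]
  gcongr
  linarith
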